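/- **Theorem (Well distributed roots).** Let $\mathcal V$ be a finite set with $n=|\mathcal V|$ elements, and let $w:\mathcal V\times\mathcal V\to[0,\infty)$ be a weight function; the ordered pairs $(x,y)$ with $w(x,y)>0$ are called edges. Assume that the network is irreducible: for any two distinct vertices $x,y$ there is a directed path of edges from $x$ to $y$. Let $X=(X(t))_{t\ge 0}$ be the continuous-time Markov process on $\mathcal V$ with right-continuous paths and generator $(Lf)(x)=\sum_{y\in\mathcal V}w(x,y)\,[f(y)-f(x)]$, let $E_x$ be the expectation for $X$ started at $x$, and let $T_{\mathcal A}=\inf\{t\ge 0: X(t)\in\mathcal A\}$ be the hitting time of $\mathcal A\subset\mathcal V$. We also write $L$ for the matrix of the generator. Let $\lambda_0=0,\lambda_1,\dots,\lambda_{n-1}\in\mathbb C$ be the eigenvalues of $-L$, with algebraic multiplicity, and let $a_k$ be the coefficient of order $k$ of the characteristic polynomial $\det(q\,\mathrm{Id}-L)=\sum_{k=0}^{n}a_kq^k$ of $L$, with $a_{n+1}=0$. A rooted spanning forest is a set $\phi$ of edges without cycles such that for each $x\in\mathcal V$ there is at most one $y$ with $(x,y)\in\phi$. Its root set $\mathcal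 R(\phi)$ is the set of vertices $x$ for which $\phi$ contains no edge $(x,y)$. For a real number $q>0$, let $\Phi_q$ be the random rooted spanning forest with $$\mathbb P(\Phi_q=\phi)=\frac{q^{|\mathcal R(\phi)|}\prod_{e\in\phi}w(e)}{Z(q)},\qquad Z(q)=\sum_{\phi}q^{|\mathcal R(\phi)|}\prod_{e\in\phi}w(e),$$ and let $\mathbb E$ be the expectation with respect to $\mathbb P$. Then, for every $q>0$ and every $x\in\mathcal V$, $$\mathbb E\Bigl[E_x\bigl[T_{\mathcal R(\Phi_q)}\bigr]\Bigr]=\frac1q\Bigl(1-\prod_{j>0}\frac{\lambda_j}{q+\lambda_j}\Bigr),$$ and for every integer $m$ with $1\le m\le n$ we have $\mathbb P(|\mathcal R(\Phi_q)|=m)>0$, $a_m\neq0$ and $$\mathbb E\Bigl[E_x\bigl[T_{\mathcal R(\Phi_q)}\bigr]\Bigm||\mathcal R(\Phi_q)|=m\Bigr]=\frac{a_{m+1}}{a_m}.$$ In particular both mean hitting times are finite and do not depend on $x$. -/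

import Mathlib

open MeasureTheory ProbabilityTheory Filter Topology
open scoped NNReal ENNReal

noncomputable section

namespace RootedForest

/-- A network on the vertex set `V`: a directed weighted graph. The weight is strictly positive
on the edges and zero on the ordered pairs that are not edges, so that it determines the edges. -/
structure Network (V : Type*) where
  /-- the weight function -/
  w : V → V → ℝ
  w_nonneg : ∀ x y, 0 ≤ w x y

variable {V : Type*}

/-- The pair `(x, y)` is an edge of the network. -/
def Network.IsEdge (N : Network V) (x y : V) : Prop := 0 < N.w x y

/-- Any two distinct vertices are joined by a directed path. -/
def Network.Irreducible (N : Network V) : Prop :=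
  ∀ x y, x ≠ y → Relation.TransGen N.IsEdge x y

/-- The matrix of the generator `(L f)(x) = ∑ y, w x y * (f y - f x)`. -/
def Network.generator [Fintype V] [DecidableEq V] (N : Network V) : Matrix V V ℝ :=
  Matrix.of fun x y => if x = y then - ∑ z ∈ Finset.univ.erase x, N.w x z else N.w x y

/-- The matrix acts on functions as the generator. -/
theorem Network.generator_mulVec [Fintype V] [DecidableEq V] (N : Network V) (f : V → ℝ) (x : V) :
    (N.generator.mulVec f) x = ∑ y, N.w x y * (f y - f x) := by
  classical
  simp only [Matrix.mulVec, dotProduct, Network.generator, Matrix.of_apply]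
  rw [← Finset.add_sum_erase _ _ (Finset.mem_univ x),
    ← Finset.add_sum_erase (a := x) Finset.univ (fun y => N.w x y * (f y - f x))
      (Finset.mem_univ x)]
  have h : ∀ y ∈ Finset.univ.erase x,
      (if x = y then - ∑ z ∈ Finset.univ.erase x, N.w x z else N.w x y) * f y
        = N.w x y * f y := by
    intro y hy
    rw [if_neg (Finset.ne_of_mem_erase hy).symm]
  rw [Finset.sum_congr rfl h]
  simp only [if_true, sub_self, mul_zero, zero_add, mul_sub, Finset.sum_sub_distrib]
  rw [← Finset.sum_mul]
  ring

/-- The eigenvalues of `-L` other than `λ₀ = 0`: the complex roots of the characteristic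
polynomial of `-L`, with their algebraic multiplicities, from which one copy of the
eigenvalue `0` is removed. -/
def Network.otherEigenvalues [Fintype V] [DecidableEq V] (N : Network V) : Multiset ℂ :=
  ((-N.generator).map (algebraMap ℝ ℂ)).charpoly.roots.erase 0

/-! ### Rooted spanning forests -/

/-- A set `φ` of ordered pairs is a rooted spanning forest: its elements are edges, every vertex
has at most one outgoing edge in `φ`, and there is no cycle. As every vertex has at most one
outgoing edge, a cycle of the underlying undirected graph is always a directed cycle. -/
structure Network.IsForest (N : Network V) (φ : Finset (V × V)) : Prop where
  edge : ∀ e ∈ φ, N.IsEdge e.1 e.2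
  out_unique : ∀ x y z, (x, y) ∈ φ → (x, z) ∈ φ → y = z
  acyclic : ∀ x, ¬ Relation.TransGen (fun a b => (a, b) ∈ φ) x x

/-- The set of all rooted spanning forests of the network. -/
def Network.Forest (N : Network V) : Type _ := {φ : Finset (V × V) // N.IsForest φ}

instance (N : Network V) [Fintype V] : Fintype N.Forest := by
  classical
  exact inferInstanceAs (Fintype {φ : Finset (V × V) // N.IsForest φ})

instance (N : Network V) : MeasurableSpace N.Forest := ⊤

variable {N : Network V}

open Classical in
/-- The root set of a forest: the vertices without outgoing edge. -/
def Network.Forest.roots [Fintype V] (φ : N.Forest) : Finset V :=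
  Finset.univ.filter fun x => ∀ y, (x, y) ∉ φ.1

/-- The weight of a forest. -/
def Network.Forest.weight (φ : N.Forest) : ℝ := ∏ e ∈ φ.1, N.w e.1 e.2

/-- The partition function `Z(q)`. -/
def Network.partitionFunction [Fintype V] (N : Network V) (q : ℝ) : ℝ :=
  ∑ φ : N.Forest, φ.weight * q ^ φ.roots.card

/-- The law of the random forest `Φ_q`, which gives the forest `φ` the mass
`w(φ) q ^ |R(φ)| / Z(q)`. -/
def Network.forestLaw [Fintype V] (N : Network V) (q : ℝ) : Measure N.Forest :=
  ∑ φ : N.Forest,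
    ENNReal.ofReal (φ.weight * q ^ φ.roots.card / N.partitionFunction q) • Measure.dirac φ

/-! ### The random walk and hitting times -/

/-- `X` is, under the laws `P x`, `x : V`, the continuous-time Markov process with state space `V`
and generator `L`, started from `x`: it has right-continuous paths (for the discrete topology of
`V`) and the finite-dimensional distributions given by the semigroup `exp (t L)`. -/
structure IsMarkovProcess [Fintype V] [DecidableEq V] {Ω : Type*} [MeasurableSpace Ω]
    (L : Matrix V V ℝ) (X : ℝ≥0 → Ω → V) (P : V → Measure Ω) : Prop where
  prob : ∀ x, IsProbabilityMeasure (P x)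
  measurable : ∀ t y, MeasurableSet {ω | X t ω = y}
  right_continuous : ∀ ω t, ∀ᶠ s in 𝓝[≥] t, X s ω = X t ω
  finite_dim : ∀ (x : V) (k : ℕ) (t : Fin (k + 1) → ℝ≥0) (y : Fin (k + 1) → V), Monotone t →
    (P x).real {ω | ∀ i, X (t i) ω = y i} =
      NormedSpace.exp ((t 0 : ℝ) • L) x (y 0) *
        ∏ i : Fin k, NormedSpace.exp (((t i.succ : ℝ) - (t i.castSucc : ℝ)) • L)
          (y i.castSucc) (y i.succ)

/-- The hitting time `inf {t ≥ 0 : X t ∈ A}`, which is `∞` if there is no such `t`. -/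
def hittingTime {Ω : Type*} (X : ℝ≥0 → Ω → V) (A : Finset V) (ω : Ω) : ℝ≥0∞ :=
  ⨅ (t : ℝ≥0) (_ : X t ω ∈ A), (t : ℝ≥0∞)

/-- The mean hitting time `E_x[T_A]`. -/
def meanHittingTime {Ω : Type*} [MeasurableSpace Ω] (X : ℝ≥0 → Ω → V) (P : V → Measure Ω)
    (A : Finset V) (x : V) : ℝ≥0∞ :=
  ∫⁻ ω, hittingTime X A ω ∂(P x)

end RootedForest

end

noncomputable section

namespace RootedForest

/-! ### Expansion of the characteristic polynomial over sets of rows -/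

section Charpoly

/-! Both formulas come from expanding `det(q - L)` over the set `R` of rows taken from `q Id`. The
remaining factor is the determinant of `N.killed R`, so `a_m` is the sum of `(N.killed R).det` over
`|R| = m`.

Two facts give these determinants a probabilistic meaning. By the matrix-forest theorem
(`Network.sum_weight_eq_det`), `(N.killed R).det` is the total weight of the forests with root set
`R`. By `meanHittingTime_eq_potential`, the mean hitting time of `R` is the solution `u` of `-L u =
1` off `R`, `u = 0` on `R`, which Cramer's rule writes as a quotient with denominator `(N.killed
R).det`. In the average over forests the denominators cancel, and only the Cramer numerators have to
be summed.

That sum is again a coefficient of the characteristic polynomial. Constants satisfy `(q - L) 1 = q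
1`, so Cramer's rule for `q - L` gives `det(q - L) = q * D`, where `D` is the determinant with
column `x` replaced by ones. Expanding `D` over rows produces exactly the Cramer numerators
(`Network.charpoly_eq_X_mul_sum`). Hence the numerators with `|R| = m` add up to `a_{m+1}`, for
every `x`, and the conditional mean is `a_{m+1} / a_m`. Without conditioning, `R = ∅` must be left
out. Its numerator is `a_1`, the product of the nonzero-index eigenvalues, which accounts for the
product in the first formula.

The hitting time is treated by discretisation. Along the grid `h ℕ` the mean is a sum of powers of
the killed kernel `exp(hL)`, which is compared with `u` by telescoping; then `h` tends to `0`
through repeated halving. -/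

theorem det_add_eq_sum {V S : Type*} [Fintype V] [DecidableEq V] [CommRing S]
    (A B : Matrix V V S) :
    (A + B).det = ∑ R : Finset V, (Matrix.of fun x y => if x ∈ R then A x y else B x y).det := by
  have h := (Matrix.detRowAlternating (R := S) (n := V)).toMultilinearMap.map_add_univ A B
  refine h.trans (Finset.sum_congr rfl fun R _ => ?_)
  change Matrix.det _ = _
  congr 1
  ext x y
  by_cases hx : x ∈ R <;> simp [Finset.piecewise, hx]

variable {V : Type*} [Fintype V] [DecidableEq V]

/-- The matrix `-L` in which the rows of the vertices of `R` are those of the identity matrix. -/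
def Network.killed (N : Network V) (R : Finset V) : Matrix V V ℝ :=
  Matrix.of fun x y => if x ∈ R then (1 : Matrix V V ℝ) x y else -N.generator x y

/-- The indicator function of the complement of `R`. -/
def coind (R : Finset V) (x : V) : ℝ := if x ∈ R then 0 else 1

theorem cramer_mulVec {S : Type*} [CommRing S] (A : Matrix V V S) (u : V → S) :
    A.cramer (A.mulVec u) = A.det • u := by
  rw [Matrix.cramer_eq_adjugate_mulVec, Matrix.mulVec_mulVec, Matrix.adjugate_mul,
    Matrix.smul_mulVec, Matrix.one_mulVec]

open Polynomial

theorem charmatrix_eq_add (N : Network V) :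
    N.generator.charmatrix = (X : ℝ[X]) • (1 : Matrix V V ℝ[X]) + (-N.generator).map C := by
  ext x y : 2
  simp [Matrix.charmatrix, Matrix.one_apply, Matrix.diagonal_apply, sub_eq_add_neg]

theorem Network.charpoly_eq_sum (N : Network V) :
    N.generator.charpoly = ∑ R : Finset V, X ^ R.card * C (N.killed R).det := by
  rw [Matrix.charpoly, charmatrix_eq_add, det_add_eq_sum]
  refine Finset.sum_congr rfl fun R _ => ?_
  have : (Matrix.of fun x y => if x ∈ R then ((X : ℝ[X]) • (1 : Matrix V V ℝ[X])) x y
      else ((-N.generator).map C) x y)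
      = Matrix.diagonal (fun x => if x ∈ R then (X : ℝ[X]) else 1) * (N.killed R).map C := by
    ext x y : 2
    by_cases hx : x ∈ R <;> simp [Network.killed, Matrix.one_apply, hx, apply_ite C]
  rw [this, Matrix.det_mul, Matrix.det_diagonal, ← RingHom.mapMatrix_apply, ← RingHom.map_det]
  simp

/-- Cramer's rule for the identity `(X - L) 1 = X 1`, followed by the row expansion. The right side
holds for each `x`, which is why the averaged hitting times do not depend on the starting point. -/
theorem Network.charpoly_eq_X_mul_sum (N : Network V) (x : V) :
    N.generator.charpoly =
      X * ∑ R : Finset V, X ^ R.card * C ((N.killed R).cramer (coind R) x) := by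
  have h1 : N.generator.charmatrix.mulVec 1 = (X : ℝ[X]) • (1 : V → ℝ[X]) := by
    have hL : N.generator.mulVec 1 = 0 := by
      ext y; rw [N.generator_mulVec]; simp
    have h3 : ((-N.generator).map C).mulVec (1 : V → ℝ[X]) = 0 := by
      ext1 y
      have := congrFun hL y
      simp only [Matrix.mulVec, dotProduct, Pi.one_apply, mul_one, Pi.zero_apply] at this
      simp [Matrix.mulVec, dotProduct, ← map_sum, this]
    rw [charmatrix_eq_add, Matrix.add_mulVec, h3, add_zero, Matrix.smul_mulVec, Matrix.one_mulVec]
  have h2 : N.generator.charpoly = X * N.generator.charmatrix.cramer 1 x := by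
    have := congrFun (cramer_mulVec N.generator.charmatrix 1) x
    rw [h1, map_smul] at this
    simpa [Matrix.charpoly] using this.symm
  rw [h2, Matrix.cramer_apply]
  congr 1
  -- The column of ones is given entirely to the summand `-L`. A row taken from `X Id` then has `0`
  -- in column `x`, so the new column is `coind R`.
  have h4 : N.generator.charmatrix.updateCol x 1 =
      ((X : ℝ[X]) • (1 : Matrix V V ℝ[X])).updateCol x 0 + ((-N.generator).map C).updateCol x 1 := by
    rw [charmatrix_eq_add]
    ext y z : 2
    by_cases hz : z = x
    · subst hz; simp
    · simp [Matrix.updateCol_ne hz]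
  rw [h4, det_add_eq_sum]
  refine Finset.sum_congr rfl fun R _ => ?_
  rw [Matrix.cramer_apply]
  have : (Matrix.of fun y z => if y ∈ R then
        (((X : ℝ[X]) • (1 : Matrix V V ℝ[X])).updateCol x 0) y z
      else (((-N.generator).map C).updateCol x 1) y z)
      = Matrix.diagonal (fun x => if x ∈ R then (X : ℝ[X]) else 1) *
        ((N.killed R).updateCol x (coind R)).map C := by
    ext y z : 2
    by_cases hz : z = x
    · subst hz
      by_cases hy : y ∈ R <;> simp [hy, coind]
    · by_cases hy : y ∈ R <;>
        simp [Network.killed, Matrix.one_apply, hy, apply_ite C, Matrix.updateCol_ne hz]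
  rw [this, Matrix.det_mul, Matrix.det_diagonal, ← RingHom.mapMatrix_apply, ← RingHom.map_det]
  simp

theorem Network.coeff_charpoly (N : Network V) (m : ℕ) :
    N.generator.charpoly.coeff m =
      ∑ R : Finset V, if R.card = m then (N.killed R).det else 0 := by
  rw [N.charpoly_eq_sum, finsetSum_coeff]
  refine Finset.sum_congr rfl fun R _ => ?_
  rw [coeff_mul_C, coeff_X_pow]
  by_cases h : R.card = m <;> simp [h, eq_comm (a := m)]

theorem Network.coeff_succ_charpoly (N : Network V) (x : V) (m : ℕ) :
    N.generator.charpoly.coeff (m + 1) =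
      ∑ R : Finset V, if R.card = m then (N.killed R).cramer (coind R) x else 0 := by
  rw [N.charpoly_eq_X_mul_sum x, coeff_X_mul, finsetSum_coeff]
  refine Finset.sum_congr rfl fun R _ => ?_
  rw [coeff_mul_C, coeff_X_pow]
  by_cases h : R.card = m <;> simp [h, eq_comm (a := m)]

end Charpoly

/-! ### The matrix-forest theorem -/

section ForestDeterminant

variable {V : Type*} [Fintype V] [DecidableEq V]

/-- The adjacency matrix of a partial function. -/
def partialMatrix (f : V → Option V) : Matrix V V ℝ :=
  Matrix.of fun x y => if f x = some y then 1 else 0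

/-- The partial function has no cycle. -/
def AcyclicFun (f : V → Option V) : Prop :=
  ∀ x, ¬ Relation.TransGen (fun a b => f a = some b) x x

theorem det_one_sub_partialMatrix_of_acyclic {f : V → Option V} (hf : AcyclicFun f) :
    (1 - partialMatrix f).det = 1 := by
  classical
  let r : V → V → Prop := fun a b => f a = some b
  -- The number of vertices reachable from `a` drops along `f`: if `f a = some b`, then `b` is
  -- reachable from `a` but not from itself. Ordering by this rank makes the matrix triangular with
  -- identity blocks.
  let rank : V → ℕ := fun a => (Finset.univ.filter fun b => Relation.TransGen r a b).card
  have hlt : ∀ a b, f a = some b → rank b < rank a := by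
    intro a b hab
    apply Finset.card_lt_card
    refine ⟨fun c hc => ?_, fun h => ?_⟩
    · simp only [Finset.mem_filter, Finset.mem_univ, true_and] at hc ⊢
      exact Relation.TransGen.head hab hc
    · have := h (x := b) (Finset.mem_filter.2 ⟨Finset.mem_univ _, Relation.TransGen.single hab⟩)
      simp only [Finset.mem_filter, Finset.mem_univ, true_and] at this
      exact hf b this
  have hT : (1 - partialMatrix f).BlockTriangular (fun a => OrderDual.toDual (rank a)) := by
    intro x y hxy
    have hxy' : rank x < rank y := hxy
    have h1 : x ≠ y := by rintro rfl; exact lt_irrefl _ hxy'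
    have h2 : f x ≠ some y := fun h => absurd (hlt x y h) (by omega)
    simp [partialMatrix, h1, h2]
  rw [hT.det]
  refine Finset.prod_eq_one fun k _ => ?_
  have : (1 - partialMatrix f).toSquareBlock (fun a => OrderDual.toDual (rank a)) k = 1 := by
    ext x y
    have h2 : f x.1 ≠ some y.1 := fun h => by
      have := hlt x.1 y.1 h
      have hx : rank x.1 = OrderDual.ofDual k := congrArg OrderDual.ofDual x.2
      have hy : rank y.1 = OrderDual.ofDual k := congrArg OrderDual.ofDual y.2
      omega
    simp [Matrix.toSquareBlock_def, partialMatrix, Matrix.one_apply, Subtype.ext_iff]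
    exact h2
  rw [this, Matrix.det_one]

theorem det_one_sub_partialMatrix_of_not_acyclic {f : V → Option V} (hf : ¬ AcyclicFun f) :
    (1 - partialMatrix f).det = 0 := by
  classical
  simp only [AcyclicFun, not_forall, not_not] at hf
  obtain ⟨x, hx⟩ := hf
  let r : V → V → Prop := fun a b => f a = some b
  change Relation.TransGen r x x at hx
  -- As `x` lies on a cycle, even `y = x` reaches `x` through its successor. So the indicator of the
  -- vertices leading to `x` is invariant under `f`, and it is a kernel vector of `1 - partialMatrix
  -- f`.
  have key : ∀ y, Relation.ReflTransGen r y x ↔ ∃ z, f y = some z ∧ Relation.ReflTransGen r z x := by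
    intro y
    constructor
    · intro h
      have h' : Relation.TransGen r y x := by
        rcases Relation.reflTransGen_iff_eq_or_transGen.1 h with h | h
        · exact h ▸ hx
        · exact h
      obtain ⟨z, hz, hzx⟩ := Relation.TransGen.head'_iff.1 h'
      exact ⟨z, hz, hzx⟩
    · rintro ⟨z, hz, hzx⟩
      exact Relation.ReflTransGen.head hz hzx
  refine Matrix.exists_mulVec_eq_zero_iff.1
    ⟨fun y => if Relation.ReflTransGen r y x then 1 else 0, fun h => ?_, ?_⟩
  · simpa using (congrFun h x).symm.trans (if_pos Relation.ReflTransGen.refl)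
  · ext y
    rw [Matrix.sub_mulVec, Matrix.one_mulVec]
    simp only [Pi.sub_apply, Pi.zero_apply, Matrix.mulVec, dotProduct, partialMatrix,
      Matrix.of_apply, key y]
    cases hy : f y with
    | none => simp
    | some z =>
      have : ∀ a, (if z = a then (1 : ℝ) else 0) * (if Relation.ReflTransGen r a x then 1 else 0)
          = if z = a then (if Relation.ReflTransGen r z x then 1 else 0) else 0 := by
        intro a
        by_cases h : z = a
        · subst h; simp
        · simp [h]
      simp only [Option.some.injEq, exists_eq_left', this, Finset.sum_ite_eq,
        Finset.mem_univ, if_true, sub_self]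

/-- The determinant of a matrix with off-diagonal rates and killing rates is a sum over the
acyclic partial functions. -/
theorem det_eq_sum_acyclic (c : V → Option V → ℝ) (M : Matrix V V ℝ)
    (hM : ∀ x y, M x y = ∑ o, c x o *
      ((1 : Matrix V V ℝ) x y - if o = some y then 1 else 0)) :
    open Classical in
    M.det = ∑ f : V → Option V, if AcyclicFun f then ∏ x, c x (f x) else 0 := by
  classical
  -- Row `x` is a combination of the rows `e_x - e_o`, with `e_none = 0` for killing. Multilinearity
  -- then chooses one `o` in each row, that is, a partial function.
  have h1 : M = fun x => ∑ o, c x o • fun y => ((1 : Matrix V V ℝ) x y - if o = some y then 1 else 0) := by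
    ext x y
    simp [hM]
  have h2 := (Matrix.detRowAlternating (R := ℝ) (n := V)).toMultilinearMap.map_sum
    (fun x (o : Option V) => c x o • fun y => ((1 : Matrix V V ℝ) x y - if o = some y then 1 else 0))
  rw [h1]
  refine h2.trans (Finset.sum_congr rfl fun f _ => ?_)
  rw [MultilinearMap.map_smul_univ]
  have h3 : (Matrix.of fun x y => (1 : Matrix V V ℝ) x y - if f x = some y then 1 else 0)
      = 1 - partialMatrix f := by
    ext x y; simp [partialMatrix]
  change (∏ x, c x (f x)) * Matrix.det (Matrix.of fun x y => (1 : Matrix V V ℝ) x y - if f x = some y then 1 else 0) = _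
  rw [h3]
  split_ifs with hf
  · rw [det_one_sub_partialMatrix_of_acyclic hf, mul_one]
  · rw [det_one_sub_partialMatrix_of_not_acyclic hf, mul_zero]


theorem Network.det_killed_eq_sum_acyclic (N : Network V) (R : Finset V) :
    open Classical in
    (N.killed R).det = ∑ f : V → Option V, if AcyclicFun f then
      ∏ x, (f x).elim (if x ∈ R then 1 else 0) (fun z => if x ∈ R then 0 else N.w x z) else 0 := by
  -- In `R` only `none` is allowed, with coefficient `1`; off `R` only `some z`, with coefficient `w
  -- x z`. The loop `z = x` does no harm, since its row `e_x - e_x` vanishes.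
  refine det_eq_sum_acyclic
    (fun x o => o.elim (if x ∈ R then 1 else 0) (fun z => if x ∈ R then 0 else N.w x z)) _ ?_
  intro x y
  rw [Fintype.sum_option]
  by_cases hx : x ∈ R
  · simp [Network.killed, hx]
  · simp only [Network.killed, hx, Matrix.of_apply, if_false, Option.elim_none, Option.elim_some,
      zero_mul, zero_add, mul_sub, Finset.sum_sub_distrib, Option.some.injEq, mul_ite, mul_one,
      mul_zero, Finset.sum_ite_eq', Finset.mem_univ, if_true, ← Finset.sum_mul, reduceCtorEq,
      sub_zero]
    by_cases hxy : x = y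
    · subst hxy
      simp only [Network.generator, Matrix.of_apply, if_true, Matrix.one_apply_eq, mul_one]
      rw [← Finset.add_sum_erase _ _ (Finset.mem_univ x)]
      ring
    · simp [Network.generator, hxy]

namespace Network.Forest
variable {N : Network V}

open Classical in
/-- The partial function that sends a vertex to the end of its outgoing edge in the forest. -/
def toFun (φ : N.Forest) (x : V) : Option V :=
  if h : ∃ y, (x, y) ∈ φ.1 then some h.choose else none

theorem toFun_eq_some (φ : N.Forest) (x y : V) : φ.toFun x = some y ↔ (x, y) ∈ φ.1 := by
  unfold toFun
  split_ifs with h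
  · rw [Option.some.injEq]
    constructor
    · rintro rfl; exact h.choose_spec
    · exact fun hy => φ.2.out_unique _ _ _ h.choose_spec hy
  · simp only [false_iff]
    exact fun hy => h ⟨y, hy⟩

omit [DecidableEq V] in
theorem mem_roots (φ : N.Forest) (x : V) : x ∈ φ.roots ↔ ∀ y, (x, y) ∉ φ.1 := by
  simp [roots]

theorem toFun_eq_none (φ : N.Forest) (x : V) : φ.toFun x = none ↔ x ∈ φ.roots := by
  rw [mem_roots, Option.eq_none_iff_forall_ne_some]
  exact forall_congr' fun y => not_congr (φ.toFun_eq_some x y)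

theorem toFun_injective : Function.Injective (toFun : N.Forest → V → Option V) := by
  intro φ ψ h
  apply Subtype.ext
  ext ⟨x, y⟩
  rw [← toFun_eq_some, ← toFun_eq_some, h]

theorem acyclic_toFun (φ : N.Forest) : AcyclicFun φ.toFun := by
  intro x hx
  refine φ.2.acyclic x (Relation.TransGen.mono (fun a b h => (φ.toFun_eq_some a b).1 h) _ _ hx)

theorem exists_toFun_eq {f : V → Option V} (hf : AcyclicFun f)
    (hw : ∀ x y, f x = some y → N.IsEdge x y) : ∃ φ : N.Forest, φ.toFun = f := by
  have hmem : ∀ x y, (x, y) ∈ (Finset.univ.filter fun e : V × V => f e.1 = some e.2) ↔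
      f x = some y := fun x y => by simp
  have hφ : N.IsForest (Finset.univ.filter fun e : V × V => f e.1 = some e.2) :=
    { edge := fun e he => hw e.1 e.2 ((hmem _ _).1 he)
      out_unique := fun x y z hy hz =>
        Option.some.inj (((hmem _ _).1 hy).symm.trans ((hmem _ _).1 hz))
      acyclic := fun x hx =>
        hf x (Relation.TransGen.mono (fun a b h => (hmem a b).1 h) _ _ hx) }
  let φ : N.Forest := ⟨_, hφ⟩
  exact ⟨φ, funext fun x => Option.ext fun y => (φ.toFun_eq_some x y).trans (hmem x y)⟩

theorem weight_eq_prod (φ : N.Forest) :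
    φ.weight = ∏ x, (φ.toFun x).elim 1 (fun z => N.w x z) := by
  classical
  have h1 : ∏ x, (φ.toFun x).elim 1 (fun z => N.w x z)
      = ∏ x ∈ Finset.univ.filter (fun x => x ∉ φ.roots), (φ.toFun x).elim 1 (fun z => N.w x z) := by
    rw [Finset.prod_filter]
    refine Finset.prod_congr rfl fun x _ => ?_
    by_cases hx : x ∈ φ.roots
    · simp [hx, (φ.toFun_eq_none x).2 hx]
    · simp [hx]
  rw [h1]
  refine Finset.prod_bij (fun e _ => e.1) ?_ ?_ ?_ ?_
  · rintro ⟨x, y⟩ he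
    simp only [Finset.mem_filter, Finset.mem_univ, true_and, mem_roots, not_forall, not_not]
    exact ⟨y, he⟩
  · rintro ⟨x, y⟩ he ⟨x', y'⟩ he' h
    obtain rfl : x = x' := h
    rw [φ.2.out_unique _ _ _ he he']
  · intro x hx
    simp only [Finset.mem_filter, Finset.mem_univ, true_and, mem_roots, not_forall, not_not] at hx
    obtain ⟨y, hy⟩ := hx
    exact ⟨(x, y), hy, rfl⟩
  · rintro ⟨x, y⟩ he
    simp [(φ.toFun_eq_some x y).2 he]

end Network.Forest

-- A forest is an acyclic partial function supported on edges, undefined exactly at the roots. The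
-- other acyclic functions in the expansion of the determinant contribute `0`: they use a pair of
-- weight zero or have the wrong set of roots.
open Classical in
theorem Network.sum_weight_eq_det (N : Network V) (R : Finset V) :
    (∑ φ : N.Forest, if φ.roots = R then φ.weight else 0) = (N.killed R).det := by
  rw [N.det_killed_eq_sum_acyclic]
  refine Finset.sum_of_injOn Network.Forest.toFun Network.Forest.toFun_injective.injOn
    (fun _ _ => Finset.mem_coe.2 (Finset.mem_univ _)) ?_ ?_
  · intro f _ hf
    split_ifs with hac
    swap
    · rfl
    by_contra hne
    rw [← ne_eq, Finset.prod_ne_zero_iff] at hne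
    obtain ⟨φ, hφ⟩ := Network.Forest.exists_toFun_eq (N := N) hac fun x y hxy => by
      have := hne x (Finset.mem_univ x)
      rw [hxy, Option.elim_some] at this
      refine (N.w_nonneg x y).lt_of_ne fun h => this ?_
      simp [← h]
    exact hf ⟨φ, Finset.mem_coe.2 (Finset.mem_univ _), hφ⟩
  · intro φ _
    rw [if_pos φ.acyclic_toFun]
    split_ifs with h
    · rw [φ.weight_eq_prod]
      refine Finset.prod_congr rfl fun x _ => ?_
      cases hx : φ.toFun x with
      | none => simp [← h, (φ.toFun_eq_none x).1 hx]
      | some y =>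
        have : x ∉ R := fun hR => by
          rw [(φ.toFun_eq_none x).2 (h ▸ hR)] at hx; cases hx
        simp [this]
    · symm
      have : ∃ x, ¬ (x ∈ φ.roots ↔ x ∈ R) := by
        by_contra! h'
        exact h (Finset.ext h')
      obtain ⟨x, hx⟩ := this
      refine Finset.prod_eq_zero (Finset.mem_univ x) ?_
      cases hx' : φ.toFun x with
      | none =>
        have h1 := (φ.toFun_eq_none x).1 hx'
        have : x ∉ R := fun h2 => hx (by simp [h1, h2])
        simp [this]
      | some y =>
        have h1 : x ∉ φ.roots := fun h1 => by
          rw [(φ.toFun_eq_none x).2 h1] at hx'; cases hx'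
        have : x ∈ R := by
          by_contra h2
          exact hx (by simp [h1, h2])
        simp [this]

end ForestDeterminant

/-! ### The Dirichlet problem off the root set and its average over forests -/

section Potential

variable {V : Type*} [Fintype V] [DecidableEq V]

theorem Network.killed_mulVec_of_mem (N : Network V) {R : Finset V} {x : V} (hx : x ∈ R)
    (v : V → ℝ) : (N.killed R).mulVec v x = v x := by
  simp [Matrix.mulVec, dotProduct, Network.killed, hx, Matrix.one_apply]

theorem Network.killed_mulVec_of_notMem (N : Network V) {R : Finset V} {x : V} (hx : x ∉ R)
    (v : V → ℝ) : (N.killed R).mulVec v x = - N.generator.mulVec v x := by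
  simp [Matrix.mulVec, dotProduct, Network.killed, hx]

/-- Maximum principle: off `R` a maximum spreads along outgoing edges, and irreducibility gives a
path to `R`, where `v` vanishes. -/
theorem Network.le_zero_of_harmonic (N : Network V) (hN : N.Irreducible) {R : Finset V}
    (hR : R.Nonempty) {v : V → ℝ} (h0 : ∀ x ∈ R, v x = 0)
    (h1 : ∀ x ∉ R, N.generator.mulVec v x = 0) (x : V) : v x ≤ 0 := by
  obtain ⟨r, hr⟩ := hR
  have : Nonempty V := ⟨r⟩
  obtain ⟨a, ha⟩ := Finite.exists_max v
  have hstep : ∀ b c, v b = v a → b ∉ R → N.IsEdge b c → v c = v a := by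
    intro b c hb hbR hbc
    have h := h1 b hbR
    rw [N.generator_mulVec] at h
    have h2 := (Finset.sum_eq_zero_iff_of_nonpos (fun y _ =>
      mul_nonpos_of_nonneg_of_nonpos (N.w_nonneg b y) (by rw [hb]; linarith [ha y]))).1 h c
      (Finset.mem_univ c)
    rcases mul_eq_zero.1 h2 with h3 | h3
    · exact absurd h3 hbc.ne'
    · linarith
  have hpath : ∀ b, Relation.ReflTransGen N.IsEdge a b → v b = v a ∨ ∃ c ∈ R, v c = v a := by
    intro b hab
    induction hab with
    | refl => exact Or.inl rfl
    | tail _ hbc ih =>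
      rcases ih with ih | ih
      · rename_i b c _
        by_cases hb : b ∈ R
        · exact Or.inr ⟨b, hb, ih⟩
        · exact Or.inl (hstep b c ih hb hbc)
      · exact Or.inr ih
  have : v a = 0 := by
    by_cases har : a = r
    · rw [har]; exact h0 r hr
    · rcases hpath r (hN a r har).to_reflTransGen with h | ⟨c, hc, h⟩
      · rw [← h, h0 r hr]
      · rw [← h, h0 c hc]
  exact this ▸ ha x

theorem Network.det_killed_ne_zero (N : Network V) (hN : N.Irreducible) {R : Finset V}
    (hR : R.Nonempty) : (N.killed R).det ≠ 0 := by
  intro hdet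
  obtain ⟨v, hv, hv0⟩ := Matrix.exists_mulVec_eq_zero_iff.2 hdet
  have h0 : ∀ x ∈ R, v x = 0 := fun x hx => by
    rw [← N.killed_mulVec_of_mem hx v, hv0]; rfl
  have h1 : ∀ x ∉ R, N.generator.mulVec v x = 0 := fun x hx => by
    have := congrFun hv0 x
    rwa [N.killed_mulVec_of_notMem hx, Pi.zero_apply, neg_eq_zero] at this
  refine hv (funext fun x => le_antisymm (N.le_zero_of_harmonic hN hR h0 h1 x) ?_)
  have := N.le_zero_of_harmonic hN hR (v := -v) (fun x hx => by simp [h0 x hx])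
    (fun x hx => by rw [Matrix.mulVec_neg, Pi.neg_apply, h1 x hx, neg_zero]) x
  simpa using this

theorem Network.det_killed_empty [Nonempty V] (N : Network V) : (N.killed ∅).det = 0 := by
  refine Matrix.exists_mulVec_eq_zero_iff.1 ⟨1, one_ne_zero, ?_⟩
  ext x
  rw [N.killed_mulVec_of_notMem (Finset.notMem_empty x), N.generator_mulVec]
  simp

theorem Network.det_killed_nonneg (N : Network V) (R : Finset V) : 0 ≤ (N.killed R).det := by
  classical
  rw [← N.sum_weight_eq_det]
  refine Finset.sum_nonneg fun φ _ => ?_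
  split_ifs
  · exact Finset.prod_nonneg fun e _ => N.w_nonneg _ _
  · exact le_rfl

omit [Fintype V] [DecidableEq V] in
theorem Network.Forest.weight_pos {N : Network V} (φ : N.Forest) : 0 < φ.weight :=
  Finset.prod_pos fun e he => φ.2.edge e he

/-- By the matrix-forest theorem the forests without roots have total weight `(N.killed ∅).det = 0`,
while each forest has positive weight. -/
theorem Network.Forest.roots_nonempty [Nonempty V] {N : Network V} (φ : N.Forest) :
    φ.roots.Nonempty := by
  classical
  rw [Finset.nonempty_iff_ne_empty]
  intro h
  have h1 := N.sum_weight_eq_det ∅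
  rw [N.det_killed_empty] at h1
  have h2 := (Finset.sum_eq_zero_iff_of_nonneg (fun φ _ => by
    split_ifs
    · exact φ.weight_pos.le
    · exact le_rfl)).1 h1 φ (Finset.mem_univ φ)
  rw [if_pos h] at h2
  exact φ.weight_pos.ne' h2

/-- The solution `u` of `-L u = 1` off `R`, `u = 0` on `R`. -/
def Network.potential (N : Network V) (R : Finset V) : V → ℝ :=
  ((N.killed R)⁻¹).mulVec (coind R)

theorem Network.killed_mulVec_potential (N : Network V) (hN : N.Irreducible) {R : Finset V}
    (hR : R.Nonempty) : (N.killed R).mulVec (N.potential R) = coind R := by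
  rw [Network.potential, Matrix.mulVec_mulVec,
    Matrix.mul_nonsing_inv _ (isUnit_iff_ne_zero.2 (N.det_killed_ne_zero hN hR)),
    Matrix.one_mulVec]

theorem Network.potential_of_mem (N : Network V) (hN : N.Irreducible) {R : Finset V}
    {x : V} (hx : x ∈ R) : N.potential R x = 0 := by
  rw [← N.killed_mulVec_of_mem hx (N.potential R), N.killed_mulVec_potential hN ⟨x, hx⟩]
  simp [coind, hx]

theorem Network.generator_mulVec_potential (N : Network V) (hN : N.Irreducible) {R : Finset V}
    (hR : R.Nonempty) {x : V} (hx : x ∉ R) : N.generator.mulVec (N.potential R) x = -1 := by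
  have := congrFun (N.killed_mulVec_potential hN hR) x
  rw [N.killed_mulVec_of_notMem hx] at this
  simp only [coind, hx, if_false] at this
  linarith

/-- At a minimum outside `R` the generator would be nonnegative, whereas it equals `-1` there. -/
theorem Network.potential_nonneg (N : Network V) (hN : N.Irreducible) {R : Finset V}
    (hR : R.Nonempty) (x : V) : 0 ≤ N.potential R x := by
  have : Nonempty V := ⟨x⟩
  obtain ⟨a, ha⟩ := Finite.exists_min (N.potential R)
  by_cases haR : a ∈ R
  · rw [← N.potential_of_mem hN haR]; exact ha x
  · have h := N.generator_mulVec_potential hN hR haR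
    rw [N.generator_mulVec] at h
    have : 0 ≤ ∑ y, N.w a y * (N.potential R y - N.potential R a) :=
      Finset.sum_nonneg fun y _ => mul_nonneg (N.w_nonneg a y) (by linarith [ha y])
    linarith

theorem Network.cramer_killed (N : Network V) (hN : N.Irreducible) {R : Finset V}
    (hR : R.Nonempty) (x : V) :
    (N.killed R).cramer (coind R) x = (N.killed R).det * N.potential R x := by
  rw [← N.killed_mulVec_potential hN hR, cramer_mulVec]
  rfl

theorem Network.sum_weight_mul (N : Network V) (F : Finset V → ℝ) :
    ∑ φ : N.Forest, φ.weight * F φ.roots = ∑ R, (N.killed R).det * F R := by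
  classical
  simp_rw [← N.sum_weight_eq_det, Finset.sum_mul]
  rw [Finset.sum_comm]
  refine Finset.sum_congr rfl fun φ _ => ?_
  simp [ite_mul]

theorem Network.sum_weight_card (N : Network V) (m : ℕ) :
    (∑ φ : N.Forest, φ.weight * if φ.roots.card = m then 1 else 0) =
      N.generator.charpoly.coeff m := by
  rw [N.coeff_charpoly, N.sum_weight_mul fun R => if R.card = m then 1 else 0]
  simp

theorem Network.sum_weight_potential_card (N : Network V) (hN : N.Irreducible) (x : V) {m : ℕ}
    (hm : 1 ≤ m) :
    (∑ φ : N.Forest, φ.weight * if φ.roots.card = m then N.potential φ.roots x else 0) =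
      N.generator.charpoly.coeff (m + 1) := by
  rw [N.coeff_succ_charpoly x,
    N.sum_weight_mul fun R => if R.card = m then N.potential R x else 0]
  refine Finset.sum_congr rfl fun R _ => ?_
  split_ifs with h
  · rw [N.cramer_killed hN (Finset.card_pos.1 (by omega))]
  · rw [mul_zero]

/-- All terms are nonnegative as forest weights, and each nonempty `R` gives a nonzero one by the
maximum principle. In particular there are forests with `m` roots. -/
theorem Network.coeff_charpoly_pos (N : Network V) (hN : N.Irreducible) {m : ℕ}
    (hm : 1 ≤ m) (hm' : m ≤ Fintype.card V) : 0 < N.generator.charpoly.coeff m := by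
  rw [N.coeff_charpoly]
  obtain ⟨R, -, hR⟩ := Finset.exists_subset_card_eq (s := (Finset.univ : Finset V)) hm'
  refine Finset.sum_pos' (fun R _ => ?_) ⟨R, Finset.mem_univ R, ?_⟩
  · split_ifs
    · exact N.det_killed_nonneg R
    · exact le_rfl
  · rw [if_pos hR]
    exact (N.det_killed_nonneg R).lt_of_ne
      (N.det_killed_ne_zero hN (Finset.card_pos.1 (by omega))).symm

theorem Network.partitionFunction_eq_eval (N : Network V) (q : ℝ) :
    N.partitionFunction q = N.generator.charpoly.eval q := by
  rw [Network.partitionFunction, N.sum_weight_mul fun R => q ^ R.card, N.charpoly_eq_sum,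
    Polynomial.eval_finsetSum]
  refine Finset.sum_congr rfl fun R _ => ?_
  rw [Polynomial.eval_mul, Polynomial.eval_pow, Polynomial.eval_X, Polynomial.eval_C, mul_comm]

theorem Network.charpoly_coeff_zero [Nonempty V] (N : Network V) :
    N.generator.charpoly.coeff 0 = 0 := by
  rw [N.coeff_charpoly]
  simp [Finset.card_eq_zero, N.det_killed_empty]

/-- The sum over forests is the sum of the Cramer numerators over nonempty `R`. The subtracted `a_1
q` is the term `R = ∅`: its determinant is zero but its numerator is not covered by a potential. -/
theorem Network.mul_sum_weight_potential (N : Network V) (hN : N.Irreducible) (x : V) (q : ℝ) :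
    q * ∑ φ : N.Forest, φ.weight * q ^ φ.roots.card * N.potential φ.roots x =
      N.generator.charpoly.eval q - N.generator.charpoly.coeff 1 * q := by
  have : Nonempty V := ⟨x⟩
  have h := N.sum_weight_mul fun R => q ^ R.card * N.potential R x
  simp only [← mul_assoc] at h
  rw [h, N.charpoly_eq_X_mul_sum x,
    Polynomial.eval_mul, Polynomial.eval_X, Polynomial.coeff_X_mul, mul_comm _ q, ← mul_sub]
  congr 1
  rw [Polynomial.eval_finsetSum, Polynomial.finsetSum_coeff, ← Finset.sum_sub_distrib]
  refine Finset.sum_congr rfl fun R _ => ?_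
  rcases R.eq_empty_or_nonempty with rfl | hR
  · simp [N.det_killed_empty]
  · have : R.card ≠ 0 := Finset.card_ne_zero.2 hR
    rw [Polynomial.coeff_mul_C, Polynomial.coeff_X_pow, if_neg this.symm, N.cramer_killed hN hR]
    simp
    ring

end Potential

/-! ### Small-time behaviour of the semigroup and iteration of a killed kernel -/

section KilledIteration

variable {V : Type*} [Fintype V] [DecidableEq V]

open scoped Matrix.Norms.Operator in
theorem tendsto_sub_exp_mulVec_div (L : Matrix V V ℝ) (v : V → ℝ) (x : V) :
    Tendsto (fun h : ℝ => (v x - (NormedSpace.exp (h • L)).mulVec v x) / h) (𝓝[>] 0)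
      (𝓝 (-L.mulVec v x)) := by
  have h1 : HasDerivAt (fun u : ℝ => NormedSpace.exp (u • L)) (NormedSpace.exp ((0 : ℝ) • L) * L) 0 :=
    hasDerivAt_exp_smul_const L (0 : ℝ)
  rw [zero_smul, NormedSpace.exp_zero, one_mul] at h1
  let F : Matrix V V ℝ →ₗ[ℝ] ℝ :=
    { toFun := fun M => M.mulVec v x
      map_add' := fun M M' => by simp [Matrix.add_mulVec]
      map_smul' := fun c M => by simp [Matrix.smul_mulVec] }
  have h2 : HasDerivAt (fun u : ℝ => F (NormedSpace.exp (u • L))) (F L) 0 :=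
    (LinearMap.toContinuousLinearMap F).hasFDerivAt.comp_hasDerivAt (0 : ℝ) h1
  have h3 := (hasDerivAt_iff_tendsto_slope_zero.1 h2).mono_left
    (nhdsWithin_mono _ (fun y (hy : 0 < y) => hy.ne'))
  refine (h3.neg).congr fun h => ?_
  simp only [zero_add, zero_smul, NormedSpace.exp_zero, F, LinearMap.coe_mk, AddHom.coe_mk,
    Matrix.one_mulVec, smul_eq_mul]
  ring

/-! ### Sub-Markovian iteration -/

/-- The iterates of `f` under the matrix `Q` killed on `A`. -/
def killedIter (Q : Matrix V V ℝ) (A : Finset V) (f : V → ℝ) : ℕ → V → ℝ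
  | 0 => f
  | J + 1 => fun x => coind A x * Q.mulVec (killedIter Q A f J) x

omit [Fintype V] in
theorem coind_nonneg (A : Finset V) (x : V) : 0 ≤ coind A x := by
  unfold coind; split_ifs <;> norm_num

theorem killedIter_mono {Q : Matrix V V ℝ} (hQ : ∀ x y, 0 ≤ Q x y) (A : Finset V) {f g : V → ℝ}
    (hfg : ∀ x, f x ≤ g x) (J : ℕ) (x : V) : killedIter Q A f J x ≤ killedIter Q A g J x := by
  induction J generalizing x with
  | zero => exact hfg x
  | succ J ih =>
    refine mul_le_mul_of_nonneg_left ?_ (coind_nonneg A x)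
    exact Finset.sum_le_sum fun y _ => mul_le_mul_of_nonneg_left (ih y) (hQ x y)

theorem killedIter_smul (Q : Matrix V V ℝ) (A : Finset V) (c : ℝ) (f : V → ℝ) (J : ℕ) :
    killedIter Q A (c • f) J = c • killedIter Q A f J := by
  induction J with
  | zero => rfl
  | succ J ih =>
    ext x
    simp only [killedIter, ih, Matrix.mulVec_smul, Pi.smul_apply, smul_eq_mul]
    ring

theorem killedIter_sub (Q : Matrix V V ℝ) (A : Finset V) (f g : V → ℝ) (J : ℕ) :
    killedIter Q A (f - g) J = killedIter Q A f J - killedIter Q A g J := by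
  induction J with
  | zero => rfl
  | succ J ih =>
    ext x
    simp only [killedIter, ih, Matrix.mulVec_sub, Pi.sub_apply]
    ring

theorem killedIter_shift (Q : Matrix V V ℝ) (A : Finset V) (f : V → ℝ) (J : ℕ) :
    killedIter Q A (killedIter Q A f 1) J = killedIter Q A f (J + 1) := by
  induction J with
  | zero => rfl
  | succ J ih =>
    ext x
    rw [killedIter, ih]
    rfl

theorem killedIter_coind_nonneg {Q : Matrix V V ℝ} (hQ : ∀ x y, 0 ≤ Q x y) (A : Finset V)
    (J : ℕ) (x : V) : 0 ≤ killedIter Q A (coind A) J x := by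
  have h := killedIter_mono hQ A (f := (0 : ℝ) • coind A) (g := coind A)
    (fun y => by simpa using coind_nonneg A y) J x
  rw [killedIter_smul] at h
  simpa using h

/-- If `u - Q u` lies between `a` and `b` off `A`, applying the killed kernel `J` times bounds the
increments of the iterates of `u` by multiples of those of `coind A`. Summing over `J` telescopes.
-/
theorem sum_killedIter_bounds {Q : Matrix V V ℝ} (hQ : ∀ x y, 0 ≤ Q x y) {A : Finset V}
    {u : V → ℝ} (hu : ∀ x, 0 ≤ u x) (huA : ∀ x ∈ A, u x = 0) {a b : ℝ} (ha : 0 < a)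
    (hab : ∀ x ∉ A, a ≤ u x - Q.mulVec u x ∧ u x - Q.mulVec u x ≤ b) (x : V) :
    Summable (fun J => killedIter Q A (coind A) J x) ∧
      a * ∑' J, killedIter Q A (coind A) J x ≤ u x ∧
      u x ≤ b * ∑' J, killedIter Q A (coind A) J x := by
  set s := fun J => killedIter Q A (coind A) J x
  set U := fun J => killedIter Q A u J x
  have hs : ∀ J, 0 ≤ s J := fun J => killedIter_coind_nonneg hQ A J x
  have hU : ∀ J, 0 ≤ U J := fun J => by
    have h := killedIter_mono hQ A (f := (0 : ℝ) • coind A) (g := u)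
      (fun y => by simpa using hu y) J x
    rw [killedIter_smul] at h
    simpa using h
  have hdiff : ∀ y, (u - killedIter Q A u 1) y = if y ∈ A then 0 else u y - Q.mulVec u y := by
    intro y
    by_cases hy : y ∈ A <;> simp [killedIter, coind, hy, huA]
  have hlow : ∀ J, a * s J ≤ U J - U (J + 1) := fun J => by
    have h := killedIter_mono hQ A (f := a • coind A) (g := u - killedIter Q A u 1)
      (fun y => by
        rw [hdiff]
        by_cases hy : y ∈ A
        · simp [coind, hy]
        · simpa [coind, hy] using (hab y hy).1) J x
    rw [killedIter_smul, killedIter_sub, killedIter_shift] at h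
    simpa using h
  have hupp : ∀ J, U J - U (J + 1) ≤ b * s J := fun J => by
    have h := killedIter_mono hQ A (f := u - killedIter Q A u 1) (g := b • coind A)
      (fun y => by
        rw [hdiff]
        by_cases hy : y ∈ A
        · simp [coind, hy]
        · simpa [coind, hy] using (hab y hy).2) J x
    rw [killedIter_smul, killedIter_sub, killedIter_shift] at h
    simpa using h
  have htel : ∀ n, ∑ J ∈ Finset.range n, (U J - U (J + 1)) = U 0 - U n := fun n =>
    Finset.sum_range_sub' U n
  have hpart : ∀ n, ∑ J ∈ Finset.range n, s J ≤ u x / a := fun n => by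
    rw [le_div_iff₀' ha, Finset.mul_sum]
    refine (Finset.sum_le_sum fun J _ => hlow J).trans ?_
    rw [htel]
    exact sub_le_self _ (hU n)
  have hsum : Summable s := summable_of_sum_range_le hs hpart
  refine ⟨hsum, ?_, ?_⟩
  · rw [← le_div_iff₀' ha]
    exact Real.tsum_le_of_sum_range_le hs hpart
  -- The upper bound also needs the remainder `U n` to vanish. Since `u ≤ c` and `u = 0` on `A`, it
  -- is at most `c * s n`, a multiple of the general term of a convergent series.
  · obtain ⟨c, hc⟩ : ∃ c : ℝ, ∀ y, u y ≤ c := (Set.finite_range u).bddAbove.imp fun c hc y =>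
      hc (Set.mem_range_self y)
    have hUs : ∀ J, U J ≤ c * s J := fun J => by
      have h := killedIter_mono hQ A (f := u) (g := c • coind A)
        (fun y => by
          by_cases hy : y ∈ A
          · simp [coind, hy, huA]
          · simpa [coind, hy] using hc y) J x
      rw [killedIter_smul] at h
      simpa using h
    have h1 : Tendsto (fun n => b * ∑ J ∈ Finset.range n, s J + c * s n) atTop
        (𝓝 (b * ∑' J, s J + c * 0)) :=
      (hsum.hasSum.tendsto_sum_nat.const_mul b).add (hsum.tendsto_atTop_zero.const_mul c)
    rw [mul_zero, add_zero] at h1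
    refine ge_of_tendsto' h1 fun n => ?_
    have h2 : U 0 - U n ≤ b * ∑ J ∈ Finset.range n, s J := by
      rw [← htel, Finset.mul_sum]
      exact Finset.sum_le_sum fun J _ => hupp J
    have h3 : U 0 = u x := rfl
    linarith [hUs n]

/-- Sum over the paths of `J` steps from `x` that avoid `A` at all times `0, ..., J`; the recursion
splits off the starting point. -/
theorem sum_paths_eq_killedIter (Q : Matrix V V ℝ) (A : Finset V) (J : ℕ) (x : V) :
    ∑ y : Fin (J + 1) → V, (∏ i, coind A (y i)) *
      ((1 : Matrix V V ℝ) x (y 0) * ∏ i : Fin J, Q (y i.castSucc) (y i.succ)) =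
      killedIter Q A (coind A) J x := by
  induction J generalizing x with
  | zero =>
    rw [← (Equiv.funUnique (Fin 1) V).symm.sum_comp]
    simp [killedIter, Matrix.one_apply]
  | succ J ih =>
    rw [← (Fin.consEquiv (fun _ => V)).sum_comp, Fintype.sum_prod_type]
    have hterm : ∀ (a : V) (z : Fin (J + 1) → V),
        (∏ i, coind A (Fin.consEquiv (fun _ => V) (a, z) i)) *
          ((1 : Matrix V V ℝ) x (Fin.consEquiv (fun _ => V) (a, z) 0) *
            ∏ i : Fin (J + 1), Q (Fin.consEquiv (fun _ => V) (a, z) i.castSucc)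
              (Fin.consEquiv (fun _ => V) (a, z) i.succ)) =
        (1 : Matrix V V ℝ) x a * (coind A a * (Q a (z 0) * ((∏ i, coind A (z i)) *
          ∏ i : Fin J, Q (z i.castSucc) (z i.succ)))) := by
      intro a z
      have e1 : ∏ i, coind A (Fin.consEquiv (fun _ => V) (a, z) i) =
          coind A a * ∏ i, coind A (z i) := Fin.prod_univ_succ _
      have e2 : ∏ i : Fin (J + 1), Q (Fin.consEquiv (fun _ => V) (a, z) i.castSucc)
          (Fin.consEquiv (fun _ => V) (a, z) i.succ) =
          Q a (z 0) * ∏ i : Fin J, Q (z i.castSucc) (z i.succ) := Fin.prod_univ_succ _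
      have e3 : Fin.consEquiv (fun _ => V) (a, z) 0 = a := rfl
      rw [e1, e2, e3]
      ring
    simp only [hterm]
    rw [Finset.sum_eq_single x]
    · simp only [killedIter, Matrix.mulVec, dotProduct, ← ih, Finset.mul_sum,
        Matrix.one_apply_eq, one_mul]
      rw [Finset.sum_comm]
      refine Finset.sum_congr rfl fun z _ => ?_
      rw [Finset.sum_eq_single (z 0)]
      · rw [Matrix.one_apply_eq]
        ring
      · intro b _ hb
        simp [hb]
      · simp
    · intro b _ hb
      simp [Matrix.one_apply_ne hb.symm]
    · simp

end KilledIteration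

/-! ### Mean hitting times as limits of means along grids -/

section HittingTime

/-! ### Hitting times along grids -/

section Grid
variable {V Ω : Type*}

/-- The first time of the grid `h ℕ` at which the path is in `A`. -/
def gridTime (X : ℝ≥0 → Ω → V) (A : Finset V) (h : ℝ≥0) (ω : Ω) : ℝ≥0∞ :=
  ⨅ (j : ℕ) (_ : X (j * h) ω ∈ A), ((j * h : ℝ≥0) : ℝ≥0∞)

-- The first index in `A` is the number of `J` for which the path avoids `A` at the indices `0, ...,
-- J`. This also holds when `A` is never met, as `h ≠ 0` makes the series infinite.
open Classical in
theorem gridTime_eq_tsum (X : ℝ≥0 → Ω → V) (A : Finset V) {h : ℝ≥0} (hh : h ≠ 0) (ω : Ω) :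
    gridTime X A h ω =
      ∑' J : ℕ, {ω | ∀ i : Fin (J + 1), X ((i : ℕ) * h) ω ∉ A}.indicator (fun _ => (h : ℝ≥0∞)) ω := by
  by_cases hex : ∃ j : ℕ, X (j * h) ω ∈ A
  · have hiff : ∀ J : ℕ, (∀ i : Fin (J + 1), X ((i : ℕ) * h) ω ∉ A) ↔ J < Nat.find hex := by
      intro J
      rw [Nat.lt_find_iff]
      exact ⟨fun H m hm => H ⟨m, by omega⟩, fun H i => H i (by omega)⟩
    rw [tsum_eq_sum (s := Finset.range (Nat.find hex))]
    · rw [Finset.sum_congr rfl fun J hJ => Set.indicator_of_mem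
        (Set.mem_ofPred.2 ((hiff J).2 (Finset.mem_range.1 hJ))) _]
      rw [Finset.sum_const, Finset.card_range, nsmul_eq_mul]
      refine le_antisymm ((iInf₂_le (Nat.find hex) (Nat.find_spec hex)).trans (by simp)) ?_
      refine le_iInf₂ fun j hj => ?_
      rw [ENNReal.coe_mul, ENNReal.coe_natCast]
      gcongr
      exact Nat.find_min' hex hj
    · intro J hJ
      refine Set.indicator_of_notMem (fun h => hJ ?_) _
      exact Finset.mem_range.2 ((hiff J).1 h)
  · push Not at hex
    have h1 : gridTime X A h ω = ∞ := by simp [gridTime, hex]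
    rw [h1]
    symm
    have h2 : ∀ J : ℕ, ω ∈ {ω | ∀ i : Fin (J + 1), X ((i : ℕ) * h) ω ∉ A} := fun J i => hex i
    rw [tsum_congr fun J => Set.indicator_of_mem (h2 J) _]
    exact ENNReal.tsum_const_eq_top_of_ne_zero (by simpa using hh)

theorem gridTime_two_mul (X : ℝ≥0 → Ω → V) (A : Finset V) (h : ℝ≥0) (ω : Ω) :
    gridTime X A h ω ≤ gridTime X A (2 * h) ω := by
  refine le_iInf₂ fun j hj => ?_
  have he : (j : ℝ≥0) * (2 * h) = ((2 * j : ℕ) : ℝ≥0) * h := by push_cast; ring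
  rw [he] at hj ⊢
  exact iInf₂_le (2 * j) hj

/-- By right-continuity the path stays in `A` for a while after each time `t` at which it is there,
so a fine enough grid has a point in `A` just after `t`. Dyadic refinements are used because the
grids are then nested and the grid times monotone. -/
theorem hittingTime_eq_iInf_gridTime (X : ℝ≥0 → Ω → V) (A : Finset V) (ω : Ω)
    (hX : ∀ t, ∀ᶠ s in 𝓝[≥] t, X s ω = X t ω) {δ : ℝ≥0} (hδ : 0 < δ) :
    hittingTime X A ω = ⨅ k : ℕ, gridTime X A (δ / 2 ^ k) ω := by
  refine le_antisymm (le_iInf fun k => le_iInf₂ fun j hj =>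
    iInf₂_le (f := fun (t : ℝ≥0) (_ : X t ω ∈ A) => (t : ℝ≥0∞)) _ hj) ?_
  refine le_iInf₂ fun t ht => ENNReal.le_of_forall_pos_le_add fun ε hε _ => ?_
  obtain ⟨r, hr, hsub⟩ := mem_nhdsGE_iff_exists_Ico_subset.1 (hX t)
  have hpos : 0 < min ε (r - t) := lt_min hε (tsub_pos_of_lt hr)
  -- The mesh is below `r - t`, so that the next grid point falls in `[t, r)` where the path is
  -- constant, and below `ε`, so that it exceeds `t` by at most `ε`.
  obtain ⟨k, hk⟩ : ∃ k : ℕ, δ / 2 ^ k < min ε (r - t) := by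
    obtain ⟨k, hk⟩ := exists_nat_gt (δ / min ε (r - t))
    refine ⟨k, ?_⟩
    rw [div_lt_comm₀ (by positivity) hpos]
    refine hk.trans ?_
    exact_mod_cast Nat.lt_two_pow_self
  set h : ℝ≥0 := δ / 2 ^ k
  have hh : 0 < h := by positivity
  have h1 : t ≤ ⌈t / h⌉₊ * h := (div_le_iff₀ hh).1 (Nat.le_ceil _)
  have h2 : ⌈t / h⌉₊ * h < t + h := by
    have := mul_lt_mul_of_pos_right (Nat.ceil_lt_add_one (zero_le (a := t / h))) hh
    rwa [add_mul, one_mul, div_mul_cancel₀ _ hh.ne'] at this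
  have h3 : X (⌈t / h⌉₊ * h) ω = X t ω := by
    refine hsub ⟨h1, h2.trans_le ?_⟩
    calc t + h ≤ t + (r - t) := by gcongr; exact hk.le.trans (min_le_right _ _)
      _ = r := add_tsub_cancel_of_le (le_of_lt hr)
  refine (iInf_le _ k).trans ((iInf₂_le ⌈t / h⌉₊ (h3 ▸ ht)).trans ?_)
  rw [← ENNReal.coe_add, ENNReal.coe_le_coe]
  exact h2.le.trans (by gcongr; exact hk.le.trans (min_le_left _ _))

end Grid

variable {V : Type*} [Fintype V] [DecidableEq V] {Ω : Type*} [MeasurableSpace Ω]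
  {L : Matrix V V ℝ} {X : ℝ≥0 → Ω → V} {P : V → Measure Ω}

theorem IsMarkovProcess.measurableSet_avoid (hX : IsMarkovProcess L X P) (A : Finset V)
    (h : ℝ≥0) (J : ℕ) : MeasurableSet {ω | ∀ i : Fin (J + 1), X ((i : ℕ) * h) ω ∉ A} := by
  have : {ω | ∀ i : Fin (J + 1), X ((i : ℕ) * h) ω ∉ A} =
      ⋂ i : Fin (J + 1), ⋂ y ∈ A, {ω | X ((i : ℕ) * h) ω = y}ᶜ := by
    ext ω
    simp only [Set.mem_ofPred_eq, Set.mem_iInter, Set.mem_compl_iff]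
    exact forall_congr' fun i => ⟨fun H y hy e => H (e ▸ hy), fun H hy => H _ hy rfl⟩
  rw [this]
  exact MeasurableSet.iInter fun i => Finset.measurableSet_biInter _ fun y _ =>
    (hX.measurable _ y).compl

theorem IsMarkovProcess.exp_nonneg (hX : IsMarkovProcess L X P) (h : ℝ≥0) (x y : V) :
    0 ≤ NormedSpace.exp ((h : ℝ) • L) x y := by
  have := hX.finite_dim x 0 (fun _ => h) (fun _ => y) monotone_const
  simp only [Finset.univ_eq_empty, Finset.prod_empty, mul_one] at this
  rw [← this]
  exact measureReal_nonneg

theorem IsMarkovProcess.measureReal_avoid (hX : IsMarkovProcess L X P) (A : Finset V)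
    (h : ℝ≥0) (J : ℕ) (x : V) :
    (P x).real {ω | ∀ i : Fin (J + 1), X ((i : ℕ) * h) ω ∉ A} =
      killedIter (NormedSpace.exp ((h : ℝ) • L)) A (coind A) J x := by
  classical
  have := hX.prob x
  have hdecomp : {ω | ∀ i : Fin (J + 1), X ((i : ℕ) * h) ω ∉ A} =
      ⋃ y ∈ Finset.univ.filter (fun y : Fin (J + 1) → V => ∀ i, y i ∉ A),
        {ω | ∀ i : Fin (J + 1), X ((i : ℕ) * h) ω = y i} := by
    ext ω
    simp only [Set.mem_ofPred_eq, Finset.mem_filter, Finset.mem_univ, true_and, Set.mem_iUnion,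
      exists_prop]
    exact ⟨fun H => ⟨fun i => X ((i : ℕ) * h) ω, H, fun _ => rfl⟩,
      fun ⟨y, hy, H⟩ i => H i ▸ hy i⟩
  rw [hdecomp, measureReal_biUnion_finset, ← sum_paths_eq_killedIter, Finset.sum_filter]
  · refine Finset.sum_congr rfl fun y _ => ?_
    have hfd := hX.finite_dim x J (fun i => (i : ℕ) * h) y
      (fun i j hij => by dsimp only; gcongr; exact hij)
    -- All increments of the grid equal `h`, and the first time is `0`, so the initial factor `exp(0
    -- L)` is the identity matrix, as in `sum_paths_eq_killedIter`.
    have h0 : ∀ i : Fin J, (((((i.succ : Fin (J + 1)) : ℕ) * h : ℝ≥0) : ℝ)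
        - (((i.castSucc : Fin (J + 1)) : ℕ) * h : ℝ≥0)) = h := fun i => by
      push_cast [Fin.val_succ, Fin.val_castSucc]; ring
    simp only [h0] at hfd
    simp only [Fin.val_zero, Nat.cast_zero, zero_mul, NNReal.coe_zero, zero_smul,
      NormedSpace.exp_zero] at hfd
    split_ifs with hy
    · have h1 : ∏ i, coind A (y i) = 1 := Finset.prod_eq_one fun i _ => by simp [coind, hy i]
      rw [hfd, h1, one_mul]
    · push Not at hy
      obtain ⟨i, hi⟩ := hy
      rw [Finset.prod_eq_zero (Finset.mem_univ i) (by simp [coind, hi]), zero_mul]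
  · intro y _ z _ hyz
    refine Set.disjoint_left.2 fun ω h1 h2 => hyz (funext fun i => ?_)
    exact (h1 i).symm.trans (h2 i)
  · intro y _
    rw [Set.ofPred_forall]
    exact MeasurableSet.iInter fun i => hX.measurable _ _

theorem IsMarkovProcess.measurable_gridTime (hX : IsMarkovProcess L X P) (A : Finset V)
    {h : ℝ≥0} (hh : h ≠ 0) : Measurable (gridTime X A h) := by
  rw [funext (gridTime_eq_tsum X A hh)]
  exact Measurable.tsum fun J =>
    measurable_const.indicator (hX.measurableSet_avoid A h J)

theorem IsMarkovProcess.lintegral_gridTime (hX : IsMarkovProcess L X P) (A : Finset V)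
    {h : ℝ≥0} (hh : h ≠ 0) (x : V) :
    ∫⁻ ω, gridTime X A h ω ∂(P x) =
      ∑' J, ENNReal.ofReal (h * killedIter (NormedSpace.exp ((h : ℝ) • L)) A (coind A) J x) := by
  have := hX.prob x
  simp_rw [gridTime_eq_tsum X A hh]
  rw [lintegral_tsum fun J =>
    (measurable_const.indicator (hX.measurableSet_avoid A h J)).aemeasurable]
  refine tsum_congr fun J => ?_
  rw [lintegral_indicator_const (hX.measurableSet_avoid A h J), ← hX.measureReal_avoid,
    ENNReal.ofReal_mul h.coe_nonneg, ENNReal.ofReal_coe_nnreal, ofReal_measureReal]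

/-- For small `h`, `u - exp(hL) u` lies between `h (1 - ε)` and `h (1 + ε)` off `A`, because `-L u =
1` there. The telescoping bounds then compare `u` with the mean grid time. -/
theorem lintegral_gridTime_bounds (N : Network V) (hN : N.Irreducible)
    (hX : IsMarkovProcess N.generator X P) {A : Finset V} (hA : A.Nonempty) (x : V) {ε : ℝ}
    (hε : 0 < ε) (hε1 : ε < 1) :
    ∃ δ : ℝ≥0, 0 < δ ∧ ∀ h : ℝ≥0, 0 < h → h ≤ δ →
      ENNReal.ofReal (N.potential A x / (1 + ε)) ≤ ∫⁻ ω, gridTime X A h ω ∂(P x) ∧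
      ∫⁻ ω, gridTime X A h ω ∂(P x) ≤ ENNReal.ofReal (N.potential A x / (1 - ε)) := by
  have hev : ∀ᶠ h : ℝ in 𝓝[>] 0, ∀ y ∉ A,
      (N.potential A y - (NormedSpace.exp (h • N.generator)).mulVec (N.potential A) y) / h
        ∈ Set.Ioo (1 - ε) (1 + ε) := by
    refine Filter.eventually_all.2 fun y => ?_
    by_cases hy : y ∈ A
    · simp [hy]
    · have := tendsto_sub_exp_mulVec_div N.generator (N.potential A) y
      rw [N.generator_mulVec_potential hN hA hy, neg_neg] at this
      filter_upwards [this.eventually (Ioo_mem_nhds (by linarith : 1 - ε < 1)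
        (by linarith : 1 < 1 + ε))] with h hh _ using hh
  obtain ⟨δ, hδ, hsub⟩ := mem_nhdsGT_iff_exists_Ioc_subset.1 hev
  refine ⟨⟨δ, le_of_lt hδ⟩, hδ, fun h hh hhδ => ?_⟩
  have hh' : (0 : ℝ) < h := hh
  have hb := hsub ⟨hh', hhδ⟩
  obtain ⟨hs, hlo, hup⟩ := sum_killedIter_bounds (hX.exp_nonneg h) (N.potential_nonneg hN hA)
    (fun y hy => N.potential_of_mem hN hy) (a := h * (1 - ε)) (b := h * (1 + ε))
    (mul_pos hh' (by linarith))
    (fun y hy => by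
      have := hb y hy
      rw [Set.mem_Ioo, lt_div_iff₀ hh', div_lt_iff₀ hh'] at this
      exact ⟨by linarith [this.1], by linarith [this.2]⟩) x
  rw [hX.lintegral_gridTime A hh.ne', ← ENNReal.ofReal_tsum_of_nonneg
    (fun J => mul_nonneg hh'.le (killedIter_coind_nonneg (hX.exp_nonneg h) A J x))
    (hs.mul_left _), tsum_mul_left]
  constructor <;> apply ENNReal.ofReal_le_ofReal
  · rw [div_le_iff₀ (by linarith)]; linarith
  · rw [le_div_iff₀ (by linarith)]; linarith

theorem meanHittingTime_eq_potential (N : Network V) (hN : N.Irreducible)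
    (hX : IsMarkovProcess N.generator X P) {A : Finset V} (hA : A.Nonempty) (x : V) :
    meanHittingTime X P A x = ENNReal.ofReal (N.potential A x) := by
  have hbounds : ∀ ε : ℝ, 0 < ε → ε < 1 →
      ENNReal.ofReal (N.potential A x / (1 + ε)) ≤ meanHittingTime X P A x ∧
      meanHittingTime X P A x ≤ ENNReal.ofReal (N.potential A x / (1 - ε)) := by
    intro ε hε hε1
    obtain ⟨δ, hδ, H⟩ := lintegral_gridTime_bounds N hN hX hA x hε hε1
    have hpos : ∀ k : ℕ, 0 < δ / 2 ^ k := fun k => by positivity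
    have hle : ∀ k : ℕ, δ / 2 ^ k ≤ δ := fun k => div_le_self zero_le (one_le_pow₀ one_le_two)
    have hanti : Antitone fun (k : ℕ) (ω : Ω) => gridTime X A (δ / 2 ^ k) ω := by
      refine antitone_nat_of_succ_le fun k ω => ?_
      have : δ / 2 ^ k = 2 * (δ / 2 ^ (k + 1)) := by field_simp; ring
      rw [this]
      exact gridTime_two_mul X A _ ω
    -- Monotone convergence for a decreasing sequence requires a finite first integral.
    have hfin : ∫⁻ ω, gridTime X A (δ / 2 ^ 0) ω ∂(P x) ≠ ∞ :=
      ((H _ (hpos 0) (hle 0)).2.trans_lt ENNReal.ofReal_lt_top).ne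
    have heq : meanHittingTime X P A x = ⨅ k : ℕ, ∫⁻ ω, gridTime X A (δ / 2 ^ k) ω ∂(P x) := by
      rw [meanHittingTime, ← lintegral_iInf (fun k => hX.measurable_gridTime A (hpos k).ne')
        hanti hfin]
      exact lintegral_congr fun ω =>
        hittingTime_eq_iInf_gridTime X A ω (hX.right_continuous ω) hδ
    rw [heq]
    exact ⟨le_iInf fun k => (H _ (hpos k) (hle k)).1, (iInf_le _ 0).trans (H _ (hpos 0) (hle 0)).2⟩
  have hlim : ∀ c : ℝ, Tendsto (fun ε : ℝ => ENNReal.ofReal (N.potential A x / (1 + c * ε)))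
      (𝓝[>] 0) (𝓝 (ENNReal.ofReal (N.potential A x))) := by
    intro c
    have h1 : ContinuousAt (fun ε : ℝ => ENNReal.ofReal (N.potential A x / (1 + c * ε))) 0 :=
      ENNReal.continuous_ofReal.continuousAt.comp
        (ContinuousAt.div (by fun_prop) (by fun_prop) (by simp))
    have h2 := h1.tendsto.mono_left (nhdsWithin_le_nhds (s := Set.Ioi 0))
    simpa using h2
  have hmem : Set.Ioo (0 : ℝ) 1 ∈ 𝓝[>] (0 : ℝ) := Ioo_mem_nhdsGT one_pos
  refine le_antisymm (ge_of_tendsto (hlim (-1)) ?_) (le_of_tendsto (hlim 1) ?_)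
  · filter_upwards [hmem] with ε hε
    simpa [sub_eq_add_neg] using (hbounds ε hε.1 hε.2).2
  · filter_upwards [hmem] with ε hε
    simpa using (hbounds ε hε.1 hε.2).1

end HittingTime

/-! ### Eigenvalues and the law of the random forest -/

section ForestLaw

variable {V : Type*} [Fintype V] [DecidableEq V]

open Polynomial in
/-- The characteristic polynomial of `L` is `X ∏ j > 0, (X + λ_j)`. -/
theorem Network.X_mul_prod_otherEigenvalues [Nonempty V] (N : Network V) :
    X * (N.otherEigenvalues.map fun lam : ℂ => X + C lam).prod =
      N.generator.charpoly.map (algebraMap ℝ ℂ) := by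
  set M : Matrix V V ℂ := N.generator.map (algebraMap ℝ ℂ)
  have hM : (-N.generator).map (algebraMap ℝ ℂ) = -M := by
    ext x y; simp [M]
  have hch : M.charpoly = N.generator.charpoly.map (algebraMap ℝ ℂ) :=
    Matrix.charpoly_map _ _
  -- The polynomial of `-M` is evaluated at `-z`; both sides acquire the same sign `(-1) ^ n`, one
  -- from the determinant and one from the `n` root factors.
  have heval : ∀ z : ℂ, (((-M).charpoly.roots).map fun lam => z + lam).prod = M.charpoly.eval z := by
    intro z
    have h1 := (IsAlgClosed.splits (-M).charpoly).eq_prod_roots_of_monic (Matrix.charpoly_monic _)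
    have h2 := congrArg (Polynomial.eval (-z)) h1
    rw [Polynomial.eval_multiset_prod, Multiset.map_map, Matrix.eval_charpoly] at h2
    have h3 : Matrix.scalar V (-z) - -M = -(Matrix.scalar V z - M) := by
      rw [map_neg]; abel
    rw [h3, Matrix.det_neg, ← Matrix.eval_charpoly] at h2
    have h4 : (Multiset.map ((Polynomial.eval (-z)) ∘ fun a => X - C a) (-M).charpoly.roots).prod
        = (-1) ^ Fintype.card V * (((-M).charpoly.roots).map fun lam => z + lam).prod := by
      have h5 : (-M).charpoly.roots.card = Fintype.card V := by
        rw [← (IsAlgClosed.splits (-M).charpoly).natDegree_eq_card_roots,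
          Matrix.charpoly_natDegree_eq_dim]
      have h6 : (Multiset.map ((Polynomial.eval (-z)) ∘ fun a => X - C a) (-M).charpoly.roots) =
          ((-M).charpoly.roots.map fun lam => z + lam).map Neg.neg := by
        rw [Multiset.map_map]
        refine Multiset.map_congr rfl fun a _ => ?_
        simp only [Function.comp_apply, Polynomial.eval_sub, Polynomial.eval_X, Polynomial.eval_C]
        ring
      rw [h6, Multiset.prod_map_neg, Multiset.card_map, h5]
    rw [h4] at h2
    exact (mul_left_cancel₀ (pow_ne_zero _ (by norm_num)) h2).symm
  -- Needed for `erase 0` to remove a root; it follows from `a_0 = 0`.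
  have h0 : (0 : ℂ) ∈ (-M).charpoly.roots := by
    rw [Polynomial.mem_roots (Matrix.charpoly_monic _).ne_zero, Polynomial.IsRoot.def]
    have h6 : M.charpoly.eval 0 = 0 := by
      rw [← Polynomial.coeff_zero_eq_eval_zero, hch, Polynomial.coeff_map, N.charpoly_coeff_zero,
        map_zero]
    rw [Matrix.eval_charpoly] at h6 ⊢
    rw [map_zero, zero_sub, Matrix.det_neg] at h6 
    rw [map_zero, zero_sub, neg_neg]
    exact (mul_eq_zero.1 h6).resolve_left (pow_ne_zero _ (by norm_num))
  refine Polynomial.funext fun z => ?_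
  rw [← hch, ← heval z, ← Multiset.cons_erase h0, Multiset.map_cons, Multiset.prod_cons, add_zero,
    Polynomial.eval_mul, Polynomial.eval_X, Polynomial.eval_multiset_prod, Multiset.map_map,
    Network.otherEigenvalues, hM]
  simp

-- Comparing the coefficients of order one in the factorisation gives `∏ λ_j = a_1`, and evaluating
-- it at `q` gives `q ∏ (q + λ_j) = det(q - L)`.
open Polynomial in
theorem Network.prod_otherEigenvalues [Nonempty V] (N : Network V) {q : ℝ} (hq : 0 < q)
    (hZ : N.generator.charpoly.eval q ≠ 0) :
    (N.otherEigenvalues.map fun lam : ℂ => lam / ((q : ℂ) + lam)).prod =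
      ((N.generator.charpoly.coeff 1 * q / N.generator.charpoly.eval q : ℝ) : ℂ) := by
  have h := N.X_mul_prod_otherEigenvalues
  have h1 : (N.otherEigenvalues.map fun lam : ℂ => lam).prod = N.generator.charpoly.coeff 1 := by
    have := congrArg (fun p => p.coeff (0 + 1)) h
    simp only [Polynomial.coeff_X_mul, Polynomial.coeff_zero_eq_eval_zero,
      Polynomial.eval_multiset_prod, Multiset.map_map, Polynomial.coeff_map] at this
    simpa using this
  have h2 : (q : ℂ) * (N.otherEigenvalues.map fun lam : ℂ => (q : ℂ) + lam).prod =
      N.generator.charpoly.eval q := by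
    have := congrArg (Polynomial.eval (q : ℂ)) h
    rw [Polynomial.eval_mul, Polynomial.eval_X, Polynomial.eval_multiset_prod,
      Multiset.map_map] at this
    have h3 : (N.generator.charpoly.map (algebraMap ℝ ℂ)).eval (q : ℂ) =
        ((N.generator.charpoly.eval q : ℝ) : ℂ) :=
      by
      rw [Polynomial.eval_map]
      exact Polynomial.eval₂_at_apply (algebraMap ℝ ℂ) q
    rw [h3] at this
    simpa using this
  rw [Multiset.prod_map_div, h1]
  have hq' : (q : ℂ) ≠ 0 := by exact_mod_cast hq.ne'
  have hZ' : ((N.generator.charpoly.eval q : ℝ) : ℂ) ≠ 0 := by exact_mod_cast hZ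
  push_cast
  rw [← h2] at hZ' ⊢
  field_simp

theorem Network.partitionFunction_pos [Nonempty V] (N : Network V) (hN : N.Irreducible) {q : ℝ}
    (hq : 0 < q) : 0 < N.partitionFunction q := by
  have hsum := N.sum_weight_card (Fintype.card V)
  have hpos := N.coeff_charpoly_pos hN (Nat.one_le_iff_ne_zero.2 Fintype.card_ne_zero) le_rfl
  rw [← hsum] at hpos
  obtain ⟨φ, -, -⟩ := Finset.exists_ne_zero_of_sum_ne_zero hpos.ne'
  exact Finset.sum_pos (fun φ _ => mul_pos φ.weight_pos (pow_pos hq _)) ⟨φ, Finset.mem_univ φ⟩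

omit [DecidableEq V] in
theorem Network.lintegral_forestLaw (N : Network V) (q : ℝ) (g : N.Forest → ℝ≥0∞) :
    ∫⁻ φ, g φ ∂(N.forestLaw q) = ∑ φ : N.Forest,
      ENNReal.ofReal (φ.weight * q ^ φ.roots.card / N.partitionFunction q) * g φ := by
  rw [Network.forestLaw, lintegral_finsetSum_measure]
  refine Finset.sum_congr rfl fun φ _ => ?_
  rw [lintegral_smul_measure, lintegral_dirac' _ measurable_from_top, smul_eq_mul]

theorem Network.lintegral_ofReal_forestLaw [Nonempty V] (N : Network V) (hN : N.Irreducible)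
    {q : ℝ} (hq : 0 < q) (g : N.Forest → ℝ) (hg : ∀ φ, 0 ≤ g φ) :
    ∫⁻ φ, ENNReal.ofReal (g φ) ∂(N.forestLaw q) = ENNReal.ofReal
      ((∑ φ : N.Forest, φ.weight * q ^ φ.roots.card * g φ) / N.partitionFunction q) := by
  have hZ := N.partitionFunction_pos hN hq
  rw [N.lintegral_forestLaw, Finset.sum_div, ENNReal.ofReal_sum_of_nonneg]
  · refine Finset.sum_congr rfl fun φ _ => ?_
    have := φ.weight_pos
    rw [← ENNReal.ofReal_mul (by positivity)]
    congr 1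
    ring
  · intro φ _
    have := φ.weight_pos
    have := hg φ
    positivity

end ForestLaw

/-! ### Conditioning on the number of roots -/

section Conditioning

variable {V : Type*} [Fintype V] [DecidableEq V]

theorem Network.setLIntegral_card_forestLaw [Nonempty V] (N : Network V) (hN : N.Irreducible)
    {q : ℝ} (hq : 0 < q) (g : N.Forest → ℝ) (hg : ∀ φ, 0 ≤ g φ) (m : ℕ) :
    ∫⁻ φ in {φ | φ.roots.card = m}, ENNReal.ofReal (g φ) ∂(N.forestLaw q) = ENNReal.ofReal
      (q ^ m / N.partitionFunction q *
        ∑ φ : N.Forest, φ.weight * if φ.roots.card = m then g φ else 0) := by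
  rw [← lintegral_indicator (MeasurableSpace.measurableSet_top)]
  have h1 : ∀ φ : N.Forest, ({φ : N.Forest | φ.roots.card = m}.indicator
      fun φ => ENNReal.ofReal (g φ)) φ =
      ENNReal.ofReal (if φ.roots.card = m then g φ else 0) := fun φ => by
    by_cases h : φ.roots.card = m
    · rw [Set.indicator_of_mem (s := {φ : N.Forest | φ.roots.card = m}) h, if_pos h]
    · rw [Set.indicator_of_notMem (s := {φ : N.Forest | φ.roots.card = m}) h, if_neg h,
        ENNReal.ofReal_zero]
  rw [lintegral_congr h1, N.lintegral_ofReal_forestLaw hN hq _ fun φ => by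
    split_ifs
    · exact hg φ
    · exact le_rfl]
  congr 1
  rw [div_mul_eq_mul_div, Finset.mul_sum]
  congr 1
  refine Finset.sum_congr rfl fun φ _ => ?_
  split_ifs with h
  · rw [h]; ring
  · simp

end Conditioning

end RootedForest

end

/-! ### The theorem on well distributed roots -/

theorem mainTheorem3 {V : Type*} [Fintype V] [DecidableEq V]
    (N : RootedForest.Network V) (hN : N.Irreducible)
    {Ω : Type*} [MeasurableSpace Ω] (X : ℝ≥0 → Ω → V) (P : V → Measure Ω)
    (hX : RootedForest.IsMarkovProcess N.generator X P)
    (q : ℝ) (hq : 0 < q) (x : V) :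
    ((∫⁻ φ, RootedForest.meanHittingTime X P φ.roots x ∂(N.forestLaw q)) ≠ ∞ ∧
      (((∫⁻ φ, RootedForest.meanHittingTime X P φ.roots x ∂(N.forestLaw q)).toReal : ℝ) : ℂ) =
        1 / (q : ℂ) *
          (1 - (N.otherEigenvalues.map fun lam : ℂ => lam / ((q : ℂ) + lam)).prod)) ∧
    ∀ m : ℕ, 1 ≤ m → m ≤ Fintype.card V →
      N.forestLaw q {φ | φ.roots.card = m} ≠ 0 ∧
      N.generator.charpoly.coeff m ≠ 0 ∧
      (∫⁻ φ, RootedForest.meanHittingTime X P φ.roots x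
          ∂((N.forestLaw q)[|{φ | φ.roots.card = m}])) ≠ ∞ ∧
      (∫⁻ φ, RootedForest.meanHittingTime X P φ.roots x
          ∂((N.forestLaw q)[|{φ | φ.roots.card = m}])).toReal =
        N.generator.charpoly.coeff (m + 1) / N.generator.charpoly.coeff m := by
  
  have : Nonempty V := ⟨x⟩
  have hT : ∀ φ : N.Forest, RootedForest.meanHittingTime X P φ.roots x =
      ENNReal.ofReal (N.potential φ.roots x) := fun φ =>
    RootedForest.meanHittingTime_eq_potential N hN hX φ.roots_nonempty x
  have hpot : ∀ φ : N.Forest, 0 ≤ N.potential φ.roots x := fun φ =>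
    N.potential_nonneg hN φ.roots_nonempty x
  have hZ := N.partitionFunction_pos hN hq
  simp only [hT]
  constructor
  · rw [N.lintegral_ofReal_forestLaw hN hq _ hpot]
    refine ⟨ENNReal.ofReal_ne_top, ?_⟩
    have hS := N.mul_sum_weight_potential hN x q
    rw [N.partitionFunction_eq_eval] at hZ ⊢
    rw [N.prod_otherEigenvalues hq hZ.ne', ENNReal.toReal_ofReal
      (div_nonneg (Finset.sum_nonneg fun φ _ => mul_nonneg
        (mul_nonneg φ.weight_pos.le (pow_pos hq _).le) (hpot φ)) hZ.le)]
    rw [mul_comm, ← eq_div_iff hq.ne'] at hS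
    rw [hS]
    norm_cast
    field_simp
  · intro m hm hm'
    have ha := N.coeff_charpoly_pos hN hm hm'
    have ha' : 0 ≤ N.generator.charpoly.coeff (m + 1) := by
      rw [← N.sum_weight_potential_card hN x hm]
      refine Finset.sum_nonneg fun φ _ => mul_nonneg φ.weight_pos.le ?_
      split_ifs
      · exact hpot φ
      · exact le_rfl
    -- On the event of `m` roots the power of `q` is constant. This common factor cancels in the
    -- conditional mean, which is therefore independent of `q`.
    have hc : 0 < q ^ m / N.partitionFunction q := div_pos (pow_pos hq _) hZ
    have hP : N.forestLaw q {φ | φ.roots.card = m} =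
        ENNReal.ofReal (q ^ m / N.partitionFunction q * N.generator.charpoly.coeff m) := by
      have := N.setLIntegral_card_forestLaw hN hq (fun _ => 1) (fun _ => zero_le_one) m
      rw [N.sum_weight_card] at this
      simpa using this
    have hI := N.setLIntegral_card_forestLaw hN hq _ hpot m
    rw [N.sum_weight_potential_card hN x hm] at hI
    have hE : ∫⁻ φ, ENNReal.ofReal (N.potential φ.roots x)
        ∂((N.forestLaw q)[|{φ | φ.roots.card = m}]) =
        ENNReal.ofReal (N.generator.charpoly.coeff (m + 1) / N.generator.charpoly.coeff m) := by
      rw [ProbabilityTheory.cond, lintegral_smul_measure, hI, hP, smul_eq_mul,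
        ← ENNReal.ofReal_inv_of_pos (mul_pos hc ha),
        ← ENNReal.ofReal_mul (inv_nonneg.2 (mul_pos hc ha).le)]
      congr 1
      field_simp
    refine ⟨?_, ha.ne', ?_, ?_⟩
    · rw [hP]
      exact (ENNReal.ofReal_pos.2 (mul_pos hc ha)).ne'
    · rw [hE]
      exact ENNReal.ofReal_ne_top
    · rw [hE, ENNReal.toReal_ofReal (div_nonneg ha' ha.le)]
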